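/- Let $0<q<1$, $l>0$ and $\psi\in\mathbb R$, and put $[a]_q=\frac{q^{a/2}-q^{-a/2}}{q^{1/2}-q^{-1/2}}$ and $(a;q)_n=\prod_{j=0}^{n-1}(1-aq^j)$. Let $\mathcal H_l$ be the Hilbert space with orthonormal basis $f_0,f_1,f_2,\dots$ carrying the discrete series representation $T_l^+$ of $U_q(\mathrm{su}_{1,1})$ with lowest weight $l$: $$J_+f_k=\sqrt{[2l+k]_q[k+1]_q}\,f_{k+1},\quad J_-f_k=\sqrt{[2l+k-1]_q[k]_q}\,f_{k-1},\quad J_0f_k=(l+k)f_k$$ (so $J_-f_0=0$). Let $$I_4^{(\psi)}=q^{-J_0/4}\left(e^{i\psi}J_++e^{-i\psi}J_-\right)q^{-J_0/4}$$ with domain the linear span of the vectors $f_k$. Then: 1. $I_4^{(\psi)}$ is densely defined, symmetric, closable and unbounded. In the basis $\tilde f_k=e^{ik\psi}f_k$ one has $I_4^{(\psi)}\tilde f_k=a_k\tilde f_{k+1}+a_{k-1}\tilde f_{k-1}$ (the last term is absent for $k=0$), where $$a_k=\frac{q^{-l-k}}{1-q}\sqrt{(1-q^{k+1})(1-q^{2l+k})}>0\qquad(k\ge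 0).$$ Moreover $a_{k-1}a_{k+1}\le a_k^2$ for all $k\ge1$, and $\sum_{k=0}^\infty a_k^{-1}<\infty$. 2. The closure $A$ of $I_4^{(\psi)}$ is not selfadjoint and has deficiency indices $(1,1)$, that is, $\dim\ker(A^*-i)=\dim\ker(A^*+i)=1$. 3. Every $\lambda\in\mathbb C$ can be written as $\lambda=-\frac{2q^{1/2}}{1-q}\cosh\theta$ with $\theta\in\mathbb C$. For every such $\theta$, a formal series $\sum_{k\ge0}b_kf_k$ with complex coefficients satisfies $I_4^{(\psi)}\sum_k b_kf_k=\lambda\sum_k b_kf_k$ (coefficientwise) if and only if $b_k=b_0P_k(\lambda)$ for all $k\geq 0$, where $$P_k(\lambda)=e^{ik\psi}\sqrt{\frac{(q;q)_k}{(q^{2l};q)_k}}\;P'_k(\lambda),$$ $$P'_k(\lambda)=(-i)^kq^{k/2}\frac{(q^{2l};q)_k}{(q;q)_k}\;{}_3\phi_1\!\left(q^{-k},-iq^le^{\theta},-iq^le^{-\theta};\,q^{2l};\,q,-q^k\right)$$ and ${}_3\phi_1(a,b,c;d;q,z)=\sum_{n\ge0}\frac{(a;q)_n(b;q)_n(c;q)_n}{(q;q)_n(d;q)_n}\left((-1)^nq^{n(n-1)/2}\right)^{-1}z^n$.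 Each $P_k$ is a polynomial of degree $k$ in $\lambda$. -/

import Mathlib

noncomputable section

namespace SUq11

/-- The Hilbert space of the discrete series representation with lowest weight `l`, in the
coordinates of its orthonormal basis `f_0, f_1, …`: the vector `∑ b_k f_k` is `(b_k)_k`. -/
abbrev HilbertL : Type := lp (fun _ : ℕ => ℂ) 2

/-- The orthonormal basis vector `f_k`. -/
def basisVec (k : ℕ) : HilbertL := lp.single 2 k (1 : ℂ)

/-- The `q`-number `[a]_q = (q^{a/2} - q^{-a/2}) / (q^{1/2} - q^{-1/2})`. -/
def qNumber (q a : ℝ) : ℝ :=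
  (q ^ (a / 2) - q ^ (-a / 2)) / (q ^ (1 / 2 : ℝ) - q ^ (-1 / 2 : ℝ))

/-- The raising operator on formal series `∑ b_k f_k` (sequences of coefficients):
`J₊ f_k = √([2l+k]_q [k+1]_q) f_{k+1}`. -/
def raising (q l : ℝ) : (ℕ → ℂ) →ₗ[ℂ] (ℕ → ℂ) where
  toFun b := fun
    | 0 => 0
    | k + 1 => (√(qNumber q (2 * l + k) * qNumber q (k + 1)) : ℂ) * b k
  map_add' b c := by
    funext k; cases k <;> simp [mul_add]
  map_smul' r b := by
    funext k; cases k <;> simp [mul_left_comm]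

/-- The lowering operator on formal series `∑ b_k f_k`:
`J₋ f_0 = 0` and `J₋ f_{k+1} = √([2l+k]_q [k+1]_q) f_k`. -/
def lowering (q l : ℝ) : (ℕ → ℂ) →ₗ[ℂ] (ℕ → ℂ) where
  toFun b := fun k => (√(qNumber q (2 * l + k) * qNumber q (k + 1)) : ℂ) * b (k + 1)
  map_add' b c := by
    funext k; simp [mul_add]
  map_smul' r b := by
    funext k; simp [mul_left_comm]

/-- The operator `q^{c J₀}` on formal series `∑ b_k f_k`, where `J₀ f_k = (l + k) f_k`. -/
def qPowJ0 (q l c : ℝ) : (ℕ → ℂ) →ₗ[ℂ] (ℕ → ℂ) where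
  toFun b := fun k => ((q ^ (c * (l + k)) : ℝ) : ℂ) * b k
  map_add' b c := by
    funext k; simp [mul_add]
  map_smul' r b := by
    funext k; simp [mul_left_comm]

/-- `q^{-J₀/4} (e^{iψ} J₊ + e^{-iψ} J₋) q^{-J₀/4}` acting on formal series `∑ b_k f_k`. -/
def formalI4 (q l ψ : ℝ) : (ℕ → ℂ) →ₗ[ℂ] (ℕ → ℂ) :=
  qPowJ0 q l (-1 / 4) ∘ₗ
    (Complex.exp (Complex.I * ψ) • raising q l + Complex.exp (-(Complex.I * ψ)) • lowering q l) ∘ₗ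
      qPowJ0 q l (-1 / 4)

/-- The linear span of the basis `f_0, f_1, …`: the finitely supported vectors. -/
def finiteVectors : Submodule ℂ HilbertL where
  carrier := {v | (Function.support (v : ℕ → ℂ)).Finite}
  zero_mem' := by
    change (Function.support (fun _ : ℕ => (0 : ℂ))).Finite
    simp
  add_mem' {v w} hv hw := by
    refine (Set.Finite.union hv hw).subset ?_
    rw [lp.coeFn_add]
    exact Function.support_add _ _
  smul_mem' c v hv := by
    refine Set.Finite.subset hv ?_
    rw [lp.coeFn_smul]
    exact Function.support_const_smul_subset c _

theorem formalI4_finite_support (q l ψ : ℝ) (b : ℕ → ℂ) (hb : (Function.support b).Finite) :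
    (Function.support (formalI4 q l ψ b)).Finite := by
  obtain ⟨N, hN⟩ := hb.bddAbove
  have h0 : ∀ k, N < k → b k = 0 := by
    intro k hk
    by_contra h
    exact absurd (hN (Function.mem_support.mpr h)) (by omega)
  refine (Set.finite_Iic (N + 1)).subset ?_
  intro k hk
  by_contra hk'
  simp only [Set.mem_Iic, not_le] at hk'
  apply hk
  cases k with
  | zero => omega
  | succ k =>
    simp [formalI4, raising, lowering, qPowJ0, h0 k (by omega), h0 (k + 1 + 1) (by omega)]

theorem memℓp_of_finite_support (b : ℕ → ℂ) (hb : (Function.support b).Finite) : Memℓp b 2 :=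
  (memℓp_zero hb).of_exponent_ge (by simp)

/-- The unbounded operator `I₄^{(ψ)} = q^{-J₀/4} (e^{iψ} J₊ + e^{-iψ} J₋) q^{-J₀/4}` in the Hilbert
space, with domain the linear span of the basis vectors. -/
def opI4 (q l ψ : ℝ) : HilbertL →ₗ.[ℂ] HilbertL where
  domain := finiteVectors
  toFun :=
    { toFun := fun v => ⟨formalI4 q l ψ (v : HilbertL),
        memℓp_of_finite_support _ (formalI4_finite_support q l ψ _ v.2)⟩
      map_add' := fun v w => by
        apply lp.ext
        simp only [Submodule.coe_add, lp.coeFn_add, map_add]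
      map_smul' := fun c v => by
        apply lp.ext
        simp only [Submodule.coe_smul, lp.coeFn_smul, map_smul, RingHom.id_apply] }

open scoped LinearPMap in
/-- The defect space `ker (A* - z)` of a densely defined operator `A` in a Hilbert space. -/
def defectSpace {H : Type*} [NormedAddCommGroup H] [InnerProductSpace ℂ H] [CompleteSpace H]
    (A : H →ₗ.[ℂ] H) (z : ℂ) : Submodule ℂ A†.domain :=
  LinearMap.ker (A†.toFun - z • A†.domain.subtype)

/-- `A` has deficiency indices `(m, n)`:
`dim ker (A* - i) = m` and `dim ker (A* + i) = n`. -/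
def HasDeficiencyIndices {H : Type*} [NormedAddCommGroup H] [InnerProductSpace ℂ H]
    [CompleteSpace H] (A : H →ₗ.[ℂ] H) (m n : Cardinal) : Prop :=
  Module.rank ℂ (defectSpace A Complex.I) = m ∧ Module.rank ℂ (defectSpace A (-Complex.I)) = n

/-- The coefficients `a_k = q^{-l-k} (1-q)⁻¹ √((1-q^{k+1})(1-q^{2l+k}))`. -/
def jacobiCoeff (q l : ℝ) (k : ℕ) : ℝ :=
  q ^ (-l - k) / (1 - q) * √((1 - q ^ (k + 1)) * (1 - q ^ (2 * l + k)))

/-- The rephased basis vector `e^{ikψ} f_k`. -/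
def rephasedVec (ψ : ℝ) (k : ℕ) : HilbertL := Complex.exp (Complex.I * k * ψ) • basisVec k

/-- The `q`-shifted factorial `(a; q)_n = ∏_{j<n} (1 - a q^j)`. -/
def qShifted {R : Type*} [CommRing R] (a q : R) (n : ℕ) : R :=
  ∏ j ∈ Finset.range n, (1 - a * q ^ j)

/-- The basic hypergeometric series
`₃φ₁(a, b, c; d; q, z) = ∑ (a;q)_n (b;q)_n (c;q)_n / ((q;q)_n (d;q)_n) ((-1)^n q^{n(n-1)/2})⁻¹ z^n`;
it is a finite sum if `a = q^{-k}`. -/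
def phi31 (a b c d q z : ℂ) : ℂ :=
  ∑' n : ℕ, qShifted a q n * qShifted b q n * qShifted c q n / (qShifted q q n * qShifted d q n) *
    ((-1) ^ n * q ^ (n * (n - 1) / 2))⁻¹ * z ^ n

/-- `P'_k = (-i)^k q^{k/2} (q^{2l};q)_k / (q;q)_k
₃φ₁(q^{-k}, -i q^l e^θ, -i q^l e^{-θ}; q^{2l}; q, -q^k)`. -/
def coeffP' (q l : ℝ) (θ : ℂ) (k : ℕ) : ℂ :=
  (-Complex.I) ^ k * ((q ^ ((k : ℝ) / 2) : ℝ) : ℂ) *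
    ((qShifted (q ^ (2 * l)) q k / qShifted q q k : ℝ) : ℂ) *
    phi31 ((q : ℂ) ^ k)⁻¹ (-Complex.I * ((q ^ l : ℝ) : ℂ) * Complex.exp θ)
      (-Complex.I * ((q ^ l : ℝ) : ℂ) * Complex.exp (-θ)) ((q ^ (2 * l) : ℝ) : ℂ) q (-(q : ℂ) ^ k)

/-- `P_k = e^{ikψ} √((q;q)_k / (q^{2l};q)_k) P'_k`. -/
def coeffP (q l ψ : ℝ) (θ : ℂ) (k : ℕ) : ℂ :=
  Complex.exp (Complex.I * k * ψ) *
    (√(qShifted q q k / qShifted (q ^ (2 * l)) q k) : ℂ) * coeffP' q l θ k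

end SUq11

end

noncomputable section

namespace SUq11

open Finset Filter Topology ComplexConjugate

/-! ### Ladder coefficients and growth of the Jacobi entries -/

section Coefficients

variable {q l : ℝ}

/-! After rephasing the basis, the operator is a Jacobi matrix with zero diagonal, and its entries
grow geometrically: `a_k ≤ q a_{k+1}` (`jacobiCoeff_le`). This one inequality carries the analysis.
It gives summable reciprocals and unboundedness. In the three-term recurrence for an eigenvector it
bounds `b_{k+2}` by a vanishing multiple of `b_{k+1}` plus `q b_k`, so every formal eigenvector, for
every complex eigenvalue, lies in the Hilbert space (`memℓp_of_formalI4_eq_smul`). Log-concavity of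
the entries does not enter this argument.

As no entry vanishes, a formal eigenvector is determined by its zeroth coefficient. Summation by
parts identifies `ker (A* - z)` with the square summable formal eigenvectors (`mem_defect_iff`), so
this kernel is a line for every `z`. At `z = i` it contradicts selfadjointness.

The explicit solution rests on a contiguous relation in `k` for the terminating `₃φ₁`. With `X =
q^k` the series is `∑ G_n(X) D_n`, where `G_n` is a signed Gaussian binomial and `D_n` satisfies a
first-order recurrence; the relation then telescopes (`sum_signedGaussBinom_mul`). Two identities
for `sqrtRatio` remove the square roots and turn it into the Jacobi recurrence. -/

theorem qNumber_eq (hq0 : 0 < q) (hq1 : q < 1) (a : ℝ) :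
    qNumber q a = q ^ ((1 - a) / 2) * (1 - q ^ a) / (1 - q) := by
  have h1 : q ^ (a / 2) = q ^ (-a / 2) * q ^ a := by
    rw [← Real.rpow_add hq0]; ring_nf
  have h2 : q ^ (1 / 2 : ℝ) = q ^ (-1 / 2 : ℝ) * q := by
    nth_rewrite 3 [← Real.rpow_one q]
    rw [← Real.rpow_add hq0]; norm_num
  have h3 : q ^ (-a / 2) = q ^ ((1 - a) / 2) * q ^ (-1 / 2 : ℝ) := by
    rw [← Real.rpow_add hq0]; ring_nf
  have h4 : q ^ (-1 / 2 : ℝ) ≠ 0 := (Real.rpow_pos_of_pos hq0 _).ne'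
  have h5 : 1 - q ≠ 0 := by linarith
  have h6 : q - 1 ≠ 0 := by linarith
  have h7 : q ^ (-1 / 2 : ℝ) * q - q ^ (-1 / 2 : ℝ) ≠ 0 := by
    rw [← mul_sub_one]; exact mul_ne_zero h4 h6
  rw [qNumber, h1, h2, h3, div_eq_div_iff h7 h5]
  ring

/-- The two outer factors contribute the exponent `-(2l+2k+1)/4` and the `q`-numbers contribute
`(1-2l-2k)/4`; the sum is exactly `-l-k`. -/
theorem weighted_ladder_coeff_eq_jacobiCoeff (hq0 : 0 < q) (hq1 : q < 1) (k : ℕ) :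
    q ^ (-1 / 4 * (l + (k + 1 : ℕ))) * √(qNumber q (2 * l + k) * qNumber q (k + 1)) *
      q ^ (-1 / 4 * (l + k)) = jacobiCoeff q l k := by
  have h5 : 0 < 1 - q := by linarith
  have h1 : qNumber q (2 * l + k) * qNumber q (k + 1) =
      (q ^ ((1 - 2 * l - 2 * k) / 4) / (1 - q)) ^ 2 *
        ((1 - q ^ (k + 1)) * (1 - q ^ (2 * l + k))) := by
    have e1 : (q ^ ((1 - 2 * l - 2 * k) / 4)) ^ 2 =
        q ^ ((1 - (2 * l + k)) / 2) * q ^ ((1 - (k + 1 : ℝ)) / 2) := by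
      rw [sq, ← Real.rpow_add hq0, ← Real.rpow_add hq0]; ring_nf
    have e2 : q ^ ((k : ℝ) + 1) = q ^ (k + 1) := by
      exact_mod_cast Real.rpow_natCast q (k + 1)
    rw [qNumber_eq hq0 hq1, qNumber_eq hq0 hq1, div_pow, e1, e2]
    field_simp
  have h2 : q ^ (-l - k) = q ^ (-1 / 4 * (l + (k + 1 : ℕ))) * q ^ ((1 - 2 * l - 2 * k) / 4) *
      q ^ (-1 / 4 * (l + k)) := by
    rw [← Real.rpow_add hq0, ← Real.rpow_add hq0]
    push_cast; ring_nf
  rw [h1, Real.sqrt_mul (sq_nonneg _), Real.sqrt_sq (by positivity), jacobiCoeff, h2]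
  ring

theorem formalI4_apply_zero (hq0 : 0 < q) (hq1 : q < 1) (ψ : ℝ) (b : ℕ → ℂ) :
    formalI4 q l ψ b 0 = Complex.exp (-(Complex.I * ψ)) * jacobiCoeff q l 0 * b 1 := by
  rw [← weighted_ladder_coeff_eq_jacobiCoeff hq0 hq1]
  simp [formalI4, raising, lowering, qPowJ0]
  ring

theorem formalI4_apply_succ (hq0 : 0 < q) (hq1 : q < 1) (ψ : ℝ) (b : ℕ → ℂ) (k : ℕ) :
    formalI4 q l ψ b (k + 1) = Complex.exp (Complex.I * ψ) * jacobiCoeff q l k * b k +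
      Complex.exp (-(Complex.I * ψ)) * jacobiCoeff q l (k + 1) * b (k + 2) := by
  rw [← weighted_ladder_coeff_eq_jacobiCoeff hq0 hq1,
    ← weighted_ladder_coeff_eq_jacobiCoeff hq0 hq1]
  simp [formalI4, raising, lowering, qPowJ0]
  ring_nf

theorem one_sub_pow_succ_pos (hq0 : 0 < q) (hq1 : q < 1) (k : ℕ) : 0 < 1 - q ^ (k + 1) := by
  exact sub_pos.mpr (pow_lt_one₀ hq0.le hq1 (Nat.succ_ne_zero k))

theorem one_sub_rpow_pos (hq0 : 0 < q) (hq1 : q < 1) (hl : 0 < l) (k : ℕ) :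
    0 < 1 - q ^ (2 * l + k) := by
  linarith [Real.rpow_lt_one hq0.le hq1 (by positivity : 0 < 2 * l + k)]

theorem jacobiCoeff_pos (hq0 : 0 < q) (hq1 : q < 1) (hl : 0 < l) (k : ℕ) :
    0 < jacobiCoeff q l k := by
  have h1 := one_sub_pow_succ_pos hq0 hq1 k
  have h2 := one_sub_rpow_pos hq0 hq1 hl k
  have h3 : 0 < 1 - q := by linarith
  unfold jacobiCoeff
  positivity

theorem rpow_neg_sub_succ (hq0 : 0 < q) (k : ℕ) :
    q ^ (-l - k) = q * q ^ (-l - (k + 1 : ℕ)) := by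
  nth_rewrite 2 [← Real.rpow_one q]
  rw [← Real.rpow_add hq0]
  push_cast; ring_nf

/-- The power of `q` gains exactly a factor `q⁻¹` at each step, while both factors under the root
increase with `k`. -/
theorem jacobiCoeff_le (hq0 : 0 < q) (hq1 : q < 1) (hl : 0 < l) (k : ℕ) :
    jacobiCoeff q l k ≤ q * jacobiCoeff q l (k + 1) := by
  have h3 : 0 < 1 - q := by linarith
  have h1 : q ^ (k + 1 + 1) ≤ q ^ (k + 1) := pow_le_pow_of_le_one hq0.le hq1.le (by omega)
  have h2 : q ^ (2 * l + (k + 1 : ℕ)) ≤ q ^ (2 * l + k) :=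
    Real.rpow_le_rpow_of_exponent_ge hq0 hq1.le (by push_cast; linarith)
  have h4 := (one_sub_pow_succ_pos hq0 hq1 (k + 1)).le
  have h5 := one_sub_rpow_pos hq0 hq1 hl k
  rw [jacobiCoeff, jacobiCoeff, rpow_neg_sub_succ hq0 k, mul_div_assoc, mul_assoc]
  gcongr

theorem jacobiCoeff_zero_le (hq0 : 0 < q) (hq1 : q < 1) (hl : 0 < l) (k : ℕ) :
    jacobiCoeff q l 0 ≤ q ^ k * jacobiCoeff q l k := by
  induction k with
  | zero => simp
  | succ k ih =>
    calc _ ≤ _ := ih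
      _ ≤ q ^ k * (q * jacobiCoeff q l (k + 1)) := by
        gcongr; exact jacobiCoeff_le hq0 hq1 hl k
      _ = _ := by ring

theorem summable_inv_jacobiCoeff (hq0 : 0 < q) (hq1 : q < 1) (hl : 0 < l) :
    Summable fun k : ℕ => (jacobiCoeff q l k)⁻¹ := by
  refine Summable.of_nonneg_of_le (fun k => (inv_pos.mpr (jacobiCoeff_pos hq0 hq1 hl k)).le)
    (fun k => ?_) ((summable_geometric_of_lt_one hq0.le hq1).mul_left (jacobiCoeff q l 0)⁻¹)
  have h0 := jacobiCoeff_pos hq0 hq1 hl 0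
  have hk := jacobiCoeff_pos hq0 hq1 hl k
  rw [inv_mul_eq_div, le_div_iff₀ h0, inv_mul_le_iff₀ hk, mul_comm]
  exact jacobiCoeff_zero_le hq0 hq1 hl k

/-- The power `q^{-l-k}` is log-linear and gives equality, so only the two factors under the root
matter. Each has the form `1 - t q^j`, and `(1-tq)² - (1-t)(1-tq²) = t(1-q)²`. -/
theorem jacobiCoeff_mul_le_sq (hq0 : 0 < q) (hq1 : q < 1) (hl : 0 < l) (k : ℕ) :
    jacobiCoeff q l k * jacobiCoeff q l (k + 2) ≤ jacobiCoeff q l (k + 1) ^ 2 := by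
  have h3 : 0 < 1 - q := by linarith
  have key : ∀ t : ℝ, 0 ≤ t → (1 - t) * (1 - t * q ^ 2) ≤ (1 - t * q) ^ 2 := fun t ht => by
    nlinarith [mul_nonneg ht (sq_nonneg (1 - q))]
  have e : ∀ j : ℕ, q ^ (2 * l + (k + j : ℕ)) = q ^ (2 * l + k) * q ^ j := fun j => by
    rw [← Real.rpow_natCast q j, ← Real.rpow_add hq0]; push_cast; ring_nf
  have a0 := one_sub_pow_succ_pos hq0 hq1 k
  have a1 := one_sub_pow_succ_pos hq0 hq1 (k + 1)
  have a2 := one_sub_pow_succ_pos hq0 hq1 (k + 2)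
  have b0 := one_sub_rpow_pos hq0 hq1 hl k
  have b1 := one_sub_rpow_pos hq0 hq1 hl (k + 1)
  have b2 := one_sub_rpow_pos hq0 hq1 hl (k + 2)
  have hA : (1 - q ^ (k + 1)) * (1 - q ^ (k + 2 + 1)) ≤ (1 - q ^ (k + 1 + 1)) ^ 2 := by
    convert key (q ^ (k + 1)) (by positivity) using 2 <;> ring
  have hB : (1 - q ^ (2 * l + k)) * (1 - q ^ (2 * l + (k + 2 : ℕ))) ≤
      (1 - q ^ (2 * l + (k + 1 : ℕ))) ^ 2 := by
    rw [e, e, pow_one]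
    exact key _ (by positivity)
  have hsqrt : √((1 - q ^ (k + 1)) * (1 - q ^ (2 * l + k))) *
      √((1 - q ^ (k + 2 + 1)) * (1 - q ^ (2 * l + (k + 2 : ℕ)))) ≤
      (1 - q ^ (k + 1 + 1)) * (1 - q ^ (2 * l + (k + 1 : ℕ))) := by
    rw [← Real.sqrt_mul (by positivity)]
    refine Real.sqrt_le_iff.mpr ⟨by positivity, ?_⟩
    calc _ = ((1 - q ^ (k + 1)) * (1 - q ^ (k + 2 + 1))) *
          ((1 - q ^ (2 * l + k)) * (1 - q ^ (2 * l + (k + 2 : ℕ)))) := by ring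
      _ ≤ (1 - q ^ (k + 1 + 1)) ^ 2 * (1 - q ^ (2 * l + (k + 1 : ℕ))) ^ 2 := by gcongr
      _ = _ := by ring
  have hc : q ^ (-l - k) * q ^ (-l - (k + 2 : ℕ)) = (q ^ (-l - (k + 1 : ℕ))) ^ 2 := by
    rw [sq, ← Real.rpow_add hq0, ← Real.rpow_add hq0]; push_cast; ring_nf
  unfold jacobiCoeff
  rw [mul_pow, Real.sq_sqrt (by positivity), div_pow, ← hc]
  calc _ = q ^ (-l - k) * q ^ (-l - (k + 2 : ℕ)) / (1 - q) ^ 2 *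
        (√((1 - q ^ (k + 1)) * (1 - q ^ (2 * l + k))) *
      √((1 - q ^ (k + 2 + 1)) * (1 - q ^ (2 * l + (k + 2 : ℕ))))) := by
        field_simp
    _ ≤ _ := by gcongr

end Coefficients

/-! ### Gaussian binomials and the telescoping identity -/

section Hypergeometric

/-- `∏_{j<n} (X q^{-j} - 1) / (1 - q^{j+1})`, which for `X = q^k` is `(-1)^n` times the
Gaussian binomial coefficient. -/
def signedGaussBinom (q X : ℂ) (n : ℕ) : ℂ :=
  ∏ j ∈ range n, (X / q ^ j - 1) / (1 - q ^ (j + 1))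

variable {q X Q : ℂ}

theorem signedGaussBinom_succ (n : ℕ) : signedGaussBinom q X (n + 1) =
    signedGaussBinom q X n * ((X / q ^ n - 1) / (1 - q ^ (n + 1))) :=
  prod_range_succ _ _

/-- Replacing `X` by `qX` shifts the numerator factors by one index and puts `qX - 1` in front. -/
theorem signedGaussBinom_mul_succ (hq : q ≠ 0) (h1 : ∀ j : ℕ, 1 - q ^ (j + 1) ≠ 0) (n : ℕ) :
    signedGaussBinom q (q * X) (n + 1) =
      (q * X - 1) / (1 - q ^ (n + 1)) * signedGaussBinom q X n := by
  induction n with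
  | zero => simp [signedGaussBinom]
  | succ n ih =>
    rw [signedGaussBinom_succ, ih, signedGaussBinom_succ]
    have := h1 n
    have := h1 (n + 1)
    field_simp
    ring

theorem one_sub_mul_signedGaussBinom_div (n : ℕ) :
    (1 - X) * signedGaussBinom q (X / q) n = (1 - X / q ^ n) * signedGaussBinom q X n := by
  induction n with
  | zero => simp [signedGaussBinom]
  | succ n ih =>
    rw [signedGaussBinom_succ, ← mul_assoc, ih, signedGaussBinom_succ]
    have : X / q / q ^ n = X / q ^ (n + 1) := by rw [div_div, pow_succ']
    rw [this]
    ring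

theorem signedGaussBinom_pow_eq_zero (hq : q ≠ 0) {k n : ℕ} (h : k < n) :
    signedGaussBinom q (q ^ k) n = 0 :=
  prod_eq_zero (mem_range.mpr h) (by rw [div_self (pow_ne_zero _ hq)]; simp)

/-- The summands do not vanish individually. By the recurrence for `D`, the boundary term at `M + 1`
is a multiple of `D (M + 1)`, as are the new summand and the old boundary term, so the induction
step is a rational identity in `q^M`. At `X = q^k` with `k < M` the boundary term is zero. -/
theorem sum_signedGaussBinom_mul (hq : q ≠ 0) (h1 : ∀ j : ℕ, 1 - q ^ (j + 1) ≠ 0) (s : ℂ)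
    (D : ℕ → ℂ) (hD : ∀ n, (1 - Q * q ^ n) * D (n + 1) = (1 - s * q ^ n - Q * q ^ (2 * n)) * D n)
    (M : ℕ) :
    ∑ n ∈ range (M + 1), ((1 - Q * X) * signedGaussBinom q (q * X) n -
        (1 - X) * signedGaussBinom q (X / q) n - s * X * signedGaussBinom q X n) * D n =
      X / q ^ M * signedGaussBinom q X M * ((1 - Q * q ^ M) * D (M + 1)) := by
  induction M with
  | zero =>
    rw [hD]
    simp [signedGaussBinom]
    ring
  | succ M ih =>
    rw [sum_range_succ, ih, hD (M + 1), one_sub_mul_signedGaussBinom_div,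
      signedGaussBinom_mul_succ hq h1, signedGaussBinom_succ]
    have hM := h1 M
    have hp : q ^ M ≠ 0 := pow_ne_zero _ hq
    rw [mul_comm 2, pow_mul]
    rw [pow_succ] at hM ⊢
    generalize q ^ M = p at *
    field_simp
    ring

end Hypergeometric

/-! ### Contiguous relation for the terminating `₃φ₁` -/

section HypergeometricRecurrence

variable {q Q A B : ℂ}

theorem qShifted_succ {R : Type*} [CommRing R] (a q : R) (n : ℕ) :
    qShifted a q (n + 1) = qShifted a q n * (1 - a * q ^ n) :=
  prod_range_succ _ _

theorem qShifted_ne_zero {a : ℂ} (h : ∀ j : ℕ, 1 - a * q ^ j ≠ 0) (n : ℕ) : qShifted a q n ≠ 0 :=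
  prod_ne_zero_iff.mpr fun j _ => h j

/-- Factor by factor: `(1 - q^j/X) · (-X)/(-q^j) = X/q^j - 1`. -/
theorem qShifted_div_eq_signedGaussBinom {X : ℂ} (hX : X ≠ 0) (hq : q ≠ 0)
    (h1 : ∀ j : ℕ, 1 - q ^ (j + 1) ≠ 0) (n : ℕ) :
    qShifted X⁻¹ q n / qShifted q q n * ((-1) ^ n * q ^ (n * (n - 1) / 2))⁻¹ * (-X) ^ n =
      signedGaussBinom q X n := by
  induction n with
  | zero => simp [qShifted, signedGaussBinom]
  | succ n ih =>
    have hs : qShifted q q n ≠ 0 :=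
      qShifted_ne_zero (fun j => by simpa [pow_succ'] using h1 j) n
    have hn := h1 n
    rw [signedGaussBinom_succ, ← ih, qShifted_succ, qShifted_succ, Nat.triangle_succ, pow_add,
      pow_succ (-1 : ℂ), pow_succ (-X), ← pow_succ' q]
    field_simp
    ring

/-- The cutoff `N` is free above `k`, so that the series for `k`, `k + 1` and `k + 2` can be summed
over one common range. -/
theorem phi31_eq_sum (hq : q ≠ 0) (h1 : ∀ j : ℕ, 1 - q ^ (j + 1) ≠ 0) {k N : ℕ} (h : k < N) :
    phi31 (q ^ k)⁻¹ A B Q q (-q ^ k) = ∑ n ∈ range N, signedGaussBinom q (q ^ k) n *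
      (qShifted A q n * qShifted B q n / qShifted Q q n) := by
  have e : ∀ n : ℕ, qShifted (q ^ k)⁻¹ q n * qShifted A q n * qShifted B q n /
      (qShifted q q n * qShifted Q q n) * ((-1) ^ n * q ^ (n * (n - 1) / 2))⁻¹ * (-q ^ k) ^ n =
      signedGaussBinom q (q ^ k) n * (qShifted A q n * qShifted B q n / qShifted Q q n) := by
    intro n
    rw [← qShifted_div_eq_signedGaussBinom (pow_ne_zero k hq) hq h1, mul_assoc (qShifted _ q n),
      mul_div_mul_comm]
    ring
  rw [phi31, tsum_congr e]
  refine tsum_eq_sum fun n hn => ?_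
  rw [signedGaussBinom_pow_eq_zero hq (h.trans_le (by simpa using hn)), zero_mul]

/-- Since `AB = -Q`, the product `(1 - Aq^n)(1 - Bq^n)` depends only on `A + B` and `Q`; this is
where the special arguments `-i q^l e^{±θ}` matter. -/
theorem qShifted_mul_div_succ (hQ : ∀ j : ℕ, 1 - Q * q ^ j ≠ 0) (hAB : A * B = -Q) (n : ℕ) :
    (1 - Q * q ^ n) * (qShifted A q (n + 1) * qShifted B q (n + 1) / qShifted Q q (n + 1)) =
      (1 - (A + B) * q ^ n - Q * q ^ (2 * n)) *
        (qShifted A q n * qShifted B q n / qShifted Q q n) := by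
  have h := hQ n
  have h2 := qShifted_ne_zero hQ n
  rw [qShifted_succ, qShifted_succ, qShifted_succ, mul_comm 2 n, pow_mul]
  generalize q ^ n = t at *
  field_simp
  linear_combination qShifted A q n * qShifted B q n * t ^ 2 * hAB

theorem phi31_recurrence_succ (hq : q ≠ 0) (h1 : ∀ j : ℕ, 1 - q ^ (j + 1) ≠ 0)
    (hQ : ∀ j : ℕ, 1 - Q * q ^ j ≠ 0) (hAB : A * B = -Q) (k : ℕ) :
    (1 - Q * q ^ (k + 1)) * phi31 (q ^ (k + 2))⁻¹ A B Q q (-q ^ (k + 2)) -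
      (1 - q ^ (k + 1)) * phi31 (q ^ k)⁻¹ A B Q q (-q ^ k) =
      (A + B) * q ^ (k + 1) * phi31 (q ^ (k + 1))⁻¹ A B Q q (-q ^ (k + 1)) := by
  have h := sum_signedGaussBinom_mul (X := q ^ (k + 1)) hq h1 (A + B)
    (fun n => qShifted A q n * qShifted B q n / qShifted Q q n) (qShifted_mul_div_succ hQ hAB) (k + 2)
  rw [signedGaussBinom_pow_eq_zero hq (by omega : k + 1 < k + 2), mul_zero, zero_mul] at h
  have e1 : q * q ^ (k + 1) = q ^ (k + 2) := (pow_succ' _ _).symm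
  have e2 : q ^ (k + 1) / q = q ^ k := by rw [pow_succ, mul_div_cancel_right₀ _ hq]
  rw [e1, e2] at h
  rw [phi31_eq_sum hq h1 (by omega : k + 2 < k + 2 + 1),
    phi31_eq_sum hq h1 (by omega : k < k + 2 + 1),
    phi31_eq_sum hq h1 (by omega : k + 1 < k + 2 + 1), ← sub_eq_zero, ← h]
  simp only [mul_sum, ← sum_sub_distrib]
  exact sum_congr rfl fun n _ => by ring

theorem phi31_zero (hq : q ≠ 0) (h1 : ∀ j : ℕ, 1 - q ^ (j + 1) ≠ 0) :
    phi31 (q ^ 0)⁻¹ A B Q q (-q ^ 0) = 1 := by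
  rw [phi31_eq_sum hq h1 zero_lt_one]
  simp [signedGaussBinom, qShifted]

theorem phi31_recurrence_zero (hq : q ≠ 0) (h1 : ∀ j : ℕ, 1 - q ^ (j + 1) ≠ 0)
    (hQ : ∀ j : ℕ, 1 - Q * q ^ j ≠ 0) (hAB : A * B = -Q) :
    (1 - Q) * phi31 (q ^ 1)⁻¹ A B Q q (-q ^ 1) = A + B := by
  have hD := qShifted_mul_div_succ hQ hAB 0
  have := h1 0
  have hq1 : q - 1 ≠ 0 := fun h => h1 0 (by rw [zero_add, pow_one, ← neg_sub, h, neg_zero])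
  rw [phi31_eq_sum hq h1 (by omega : 1 < 1 + 1), sum_range_succ _ 1, sum_range_one]
  simp only [signedGaussBinom, prod_range_zero, prod_range_one, zero_add, pow_zero, pow_one,
    div_one, mul_zero, mul_one] at hD this ⊢
  have e : (q - 1) / (1 - q) = -1 := by field_simp; ring
  rw [e, mul_add, mul_left_comm _ (-1 : ℂ), hD]
  simp [qShifted]

end HypergeometricRecurrence

/-! ### Formal eigenvectors: explicit form, uniqueness, square summability -/

section FormalEigenvectors

variable {q l : ℝ}

/-- The factor `√((q^{2l};q)_k / (q;q)_k)`. -/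
def sqrtRatio (q l : ℝ) (k : ℕ) : ℝ := √(qShifted (q ^ (2 * l)) q k / qShifted q q k)

theorem qShifted_rpow_pos (hq0 : 0 < q) (hq1 : q < 1) (hl : 0 < l) (k : ℕ) :
    0 < qShifted (q ^ (2 * l)) q k :=
  prod_pos fun j _ => by
    rw [← Real.rpow_natCast, ← Real.rpow_add hq0]
    exact one_sub_rpow_pos hq0 hq1 hl j

theorem qShifted_self_pos (hq0 : 0 < q) (hq1 : q < 1) (k : ℕ) : 0 < qShifted q q k :=
  prod_pos fun j _ => by
    rw [← pow_succ']
    exact one_sub_pow_succ_pos hq0 hq1 j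

theorem sqrt_ratio_mul (hq0 : 0 < q) (hq1 : q < 1) (hl : 0 < l) (k : ℕ) :
    √(qShifted q q k / qShifted (q ^ (2 * l)) q k) *
      (qShifted (q ^ (2 * l)) q k / qShifted q q k) = sqrtRatio q l k := by
  have h1 := qShifted_rpow_pos hq0 hq1 hl k
  have h2 := qShifted_self_pos hq0 hq1 k
  have h3 : 0 < qShifted (q ^ (2 * l)) q k / qShifted q q k := by positivity
  rw [sqrtRatio, ← inv_div, Real.sqrt_inv]
  nth_rewrite 2 [← Real.mul_self_sqrt h3.le]
  have := Real.sqrt_pos.mpr h3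
  field_simp

theorem sqrtRatio_succ (hq0 : 0 < q) (hq1 : q < 1) (hl : 0 < l) (k : ℕ) :
    sqrtRatio q l (k + 1) = sqrtRatio q l k *
      (√(1 - q ^ (2 * l + k)) / √(1 - q ^ (k + 1))) := by
  have h1 := qShifted_rpow_pos hq0 hq1 hl k
  have h2 := qShifted_self_pos hq0 hq1 k
  have h3 := one_sub_rpow_pos hq0 hq1 hl k
  rw [sqrtRatio, sqrtRatio, qShifted_succ, qShifted_succ, ← Real.sqrt_div h3.le,
    ← Real.sqrt_mul (by positivity), mul_div_mul_comm, ← pow_succ', ← Real.rpow_natCast q k,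
    ← Real.rpow_add hq0]

/-- Passing from `k` to `k + 1` in `sqrtRatio` cancels one root of `a_k` and squares the other. With
`jacobiCoeff_mul_sqrtRatio` this makes the recurrence for `phiFactor` free of roots. -/
theorem jacobiCoeff_mul_sqrtRatio_succ (hq0 : 0 < q) (hq1 : q < 1) (hl : 0 < l) (k : ℕ) :
    jacobiCoeff q l k * sqrtRatio q l (k + 1) * ((1 - q) * (q ^ l * q ^ k)) =
      (1 - (q ^ l) ^ 2 * q ^ k) * sqrtRatio q l k := by
  have h3 := one_sub_rpow_pos hq0 hq1 hl k
  have h4 := one_sub_pow_succ_pos hq0 hq1 k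
  have h5 : 1 - q ≠ 0 := by linarith
  have e : q ^ (2 * l + k) = (q ^ l) ^ 2 * q ^ k := by
    rw [Real.rpow_add hq0, Real.rpow_natCast, mul_comm 2 l, Real.rpow_mul hq0.le,
      Real.rpow_ofNat]
  have e2 : q ^ (-l - k) = (q ^ l * q ^ k)⁻¹ := by
    rw [← Real.rpow_natCast, ← Real.rpow_add hq0, ← Real.rpow_neg hq0.le]; ring_nf
  have h6 : 0 < q ^ l := Real.rpow_pos_of_pos hq0 _
  have h7 := Real.sqrt_pos.mpr h4
  rw [sqrtRatio_succ hq0 hq1 hl, jacobiCoeff, Real.sqrt_mul h4.le, e2, ← e]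
  nth_rewrite 3 [← Real.mul_self_sqrt h3.le]
  field_simp

theorem jacobiCoeff_mul_sqrtRatio (hq0 : 0 < q) (hq1 : q < 1) (hl : 0 < l) (k : ℕ) :
    jacobiCoeff q l k * sqrtRatio q l k * ((1 - q) * (q ^ l * q ^ k)) =
      (1 - q ^ (k + 1)) * sqrtRatio q l (k + 1) := by
  have h3 := one_sub_rpow_pos hq0 hq1 hl k
  have h4 := one_sub_pow_succ_pos hq0 hq1 k
  have h5 : 1 - q ≠ 0 := by linarith
  have e2 : q ^ (-l - k) = (q ^ l * q ^ k)⁻¹ := by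
    rw [← Real.rpow_natCast, ← Real.rpow_add hq0, ← Real.rpow_neg hq0.le]; ring_nf
  have h6 : 0 < q ^ l := Real.rpow_pos_of_pos hq0 _
  have h7 := Real.sqrt_pos.mpr h4
  rw [sqrtRatio_succ hq0 hq1 hl, jacobiCoeff, Real.sqrt_mul h4.le, e2]
  nth_rewrite 2 [← Real.mul_self_sqrt h4.le]
  field_simp

/-- The terminating `₃φ₁` factor of `coeffP'`. -/
def phiFactor (q l : ℝ) (θ : ℂ) (k : ℕ) : ℂ :=
  phi31 ((q : ℂ) ^ k)⁻¹ (-Complex.I * ((q ^ l : ℝ) : ℂ) * Complex.exp θ)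
    (-Complex.I * ((q ^ l : ℝ) : ℂ) * Complex.exp (-θ)) ((q ^ (2 * l) : ℝ) : ℂ) q (-(q : ℂ) ^ k)

theorem coeffP_eq (hq0 : 0 < q) (hq1 : q < 1) (hl : 0 < l) (ψ : ℝ) (θ : ℂ) (k : ℕ) :
    coeffP q l ψ θ k = (Complex.exp (Complex.I * ψ) * -Complex.I * (q ^ (1 / 2 : ℝ) : ℝ)) ^ k *
      sqrtRatio q l k * phiFactor q l θ k := by
  have e1 : Complex.exp (Complex.I * k * ψ) = Complex.exp (Complex.I * ψ) ^ k := by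
    rw [← Complex.exp_nat_mul]; ring_nf
  have e2 : q ^ ((k : ℝ) / 2) = (q ^ (1 / 2 : ℝ)) ^ k := by
    rw [← Real.rpow_natCast, ← Real.rpow_mul hq0.le]; ring_nf
  rw [coeffP, coeffP', ← sqrt_ratio_mul hq0 hq1 hl, e1, e2, phiFactor]
  push_cast
  ring

theorem exp_arg_mul (l' θ : ℂ) : (-Complex.I * l' * Complex.exp θ) *
    (-Complex.I * l' * Complex.exp (-θ)) = -(l' ^ 2) := by
  have h : Complex.exp θ * Complex.exp (-θ) = 1 := by rw [← Complex.exp_add]; simp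
  linear_combination (Complex.I ^ 2 * l' ^ 2) * h + l' ^ 2 * Complex.I_sq

theorem exp_arg_add (l' θ : ℂ) : (-Complex.I * l' * Complex.exp θ) +
    (-Complex.I * l' * Complex.exp (-θ)) = -(2 * Complex.I * l' * Complex.cosh θ) := by
  rw [Complex.cosh]; ring

theorem one_sub_cpow_ne_zero (hq0 : 0 < q) (hq1 : q < 1) (j : ℕ) :
    1 - (q : ℂ) ^ (j + 1) ≠ 0 := by
  exact_mod_cast (one_sub_pow_succ_pos hq0 hq1 j).ne'

theorem one_sub_sq_mul_ne_zero (hq0 : 0 < q) (hq1 : q < 1) (hl : 0 < l) (j : ℕ) :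
    1 - ((q ^ (2 * l) : ℝ) : ℂ) * (q : ℂ) ^ j ≠ 0 := by
  have h := (one_sub_rpow_pos hq0 hq1 hl j).ne'
  rw [Real.rpow_add hq0, Real.rpow_natCast] at h
  exact_mod_cast h

theorem rpow_two_mul_eq_sq (hq0 : 0 < q) : ((q ^ (2 * l) : ℝ) : ℂ) = ((q ^ l : ℝ) : ℂ) ^ 2 := by
  rw [mul_comm 2 l, Real.rpow_mul hq0.le, Real.rpow_ofNat]; push_cast; rfl

theorem phiFactor_zero (hq0 : 0 < q) (hq1 : q < 1) (θ : ℂ) : phiFactor q l θ 0 = 1 :=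
  phi31_zero (by exact_mod_cast hq0.ne') (one_sub_cpow_ne_zero hq0 hq1)

theorem phiFactor_one (hq0 : 0 < q) (hq1 : q < 1) (hl : 0 < l) (θ : ℂ) :
    (1 - ((q ^ l : ℝ) : ℂ) ^ 2) * phiFactor q l θ 1 =
      -(2 * Complex.I * (q ^ l : ℝ) * Complex.cosh θ) := by
  rw [← exp_arg_add, ← rpow_two_mul_eq_sq hq0]
  exact phi31_recurrence_zero (by exact_mod_cast hq0.ne') (one_sub_cpow_ne_zero hq0 hq1)
    (one_sub_sq_mul_ne_zero hq0 hq1 hl) (by rw [exp_arg_mul, rpow_two_mul_eq_sq hq0])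

theorem phiFactor_succ (hq0 : 0 < q) (hq1 : q < 1) (hl : 0 < l) (θ : ℂ) (k : ℕ) :
    (1 - ((q ^ l : ℝ) : ℂ) ^ 2 * (q : ℂ) ^ (k + 1)) * phiFactor q l θ (k + 2) -
      (1 - (q : ℂ) ^ (k + 1)) * phiFactor q l θ k =
      -(2 * Complex.I * (q ^ l : ℝ) * Complex.cosh θ) * (q : ℂ) ^ (k + 1) *
        phiFactor q l θ (k + 1) := by
  rw [← exp_arg_add, ← rpow_two_mul_eq_sq hq0]
  exact phi31_recurrence_succ (by exact_mod_cast hq0.ne') (one_sub_cpow_ne_zero hq0 hq1)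
    (one_sub_sq_mul_ne_zero hq0 hq1 hl) (by rw [exp_arg_mul, rpow_two_mul_eq_sq hq0]) k

theorem coeffP_zero (hq0 : 0 < q) (hq1 : q < 1) (hl : 0 < l) (ψ : ℝ) (θ : ℂ) :
    coeffP q l ψ θ 0 = 1 := by
  rw [coeffP_eq hq0 hq1 hl, phiFactor_zero hq0 hq1]
  simp [sqrtRatio, qShifted]

theorem rpow_half_sq (hq0 : 0 < q) : ((q ^ (1 / 2 : ℝ) : ℝ) : ℂ) ^ 2 = q := by
  norm_cast
  rw [← Real.sqrt_eq_rpow, Real.sq_sqrt hq0.le]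

theorem exp_neg_mul_exp (ψ : ℝ) :
    Complex.exp (-(Complex.I * ψ)) * Complex.exp (Complex.I * ψ) = 1 := by
  rw [← Complex.exp_add]; simp

theorem coeffP_recurrence_zero (hq0 : 0 < q) (hq1 : q < 1) (hl : 0 < l) (ψ : ℝ) (θ : ℂ) :
    Complex.exp (-(Complex.I * ψ)) * jacobiCoeff q l 0 * coeffP q l ψ θ 1 =
      -(2 * ((q ^ (1 / 2 : ℝ) : ℝ) : ℂ) / (1 - q)) * Complex.cosh θ * coeffP q l ψ θ 0 := by
  have hu : ((q ^ l : ℝ) : ℂ) ≠ 0 := by exact_mod_cast (Real.rpow_pos_of_pos hq0 l).ne'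
  have hd : 1 - (q : ℂ) ≠ 0 := by simpa using one_sub_cpow_ne_zero hq0 hq1 0
  have ha := congrArg (fun x : ℝ => (x : ℂ)) (jacobiCoeff_mul_sqrtRatio_succ hq0 hq1 hl 0)
  have hr : sqrtRatio q l 0 = 1 := by simp [sqrtRatio, qShifted]
  have hφ := phiFactor_one hq0 hq1 hl θ
  have he := exp_neg_mul_exp ψ
  rw [coeffP_zero hq0 hq1 hl, coeffP_eq hq0 hq1 hl]
  simp only [hr] at ha
  push_cast [zero_add, pow_zero, mul_one, pow_one] at ha ⊢
  have hI := Complex.I_sq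
  generalize Complex.exp (-(Complex.I * ψ)) = e' at *
  generalize Complex.exp (Complex.I * ψ) = e at *
  generalize ((q ^ l : ℝ) : ℂ) = u at *
  generalize ((q ^ (1 / 2 : ℝ) : ℝ) : ℂ) = s at *
  have hdiv : (1 - (q : ℂ)) * (2 * s / (1 - q)) = 2 * s := mul_div_cancel₀ _ hd
  refine mul_left_cancel₀ (mul_ne_zero hd hu) ?_
  linear_combination (jacobiCoeff q l 0 * sqrtRatio q l 1 * phiFactor q l θ 1 * (-Complex.I) * s *
    (1 - q) * u) * he + (-Complex.I * s * phiFactor q l θ 1) * ha + (-Complex.I * s) * hφ +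
    (2 * s * u * Complex.cosh θ) * hI + (u * Complex.cosh θ) * hdiv

theorem coeffP_recurrence_succ (hq0 : 0 < q) (hq1 : q < 1) (hl : 0 < l) (ψ : ℝ) (θ : ℂ) (k : ℕ) :
    Complex.exp (Complex.I * ψ) * jacobiCoeff q l k * coeffP q l ψ θ k +
      Complex.exp (-(Complex.I * ψ)) * jacobiCoeff q l (k + 1) * coeffP q l ψ θ (k + 2) =
      -(2 * ((q ^ (1 / 2 : ℝ) : ℝ) : ℂ) / (1 - q)) * Complex.cosh θ *
        coeffP q l ψ θ (k + 1) := by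
  have hu : ((q ^ l : ℝ) : ℂ) ≠ 0 := by exact_mod_cast (Real.rpow_pos_of_pos hq0 l).ne'
  have hd : 1 - (q : ℂ) ≠ 0 := by simpa using one_sub_cpow_ne_zero hq0 hq1 0
  have hqc : (q : ℂ) ≠ 0 := by exact_mod_cast hq0.ne'
  have ha := congrArg (fun x : ℝ => (x : ℂ)) (jacobiCoeff_mul_sqrtRatio_succ hq0 hq1 hl (k + 1))
  have hb := congrArg (fun x : ℝ => (x : ℂ)) (jacobiCoeff_mul_sqrtRatio hq0 hq1 hl k)
  have hφ := phiFactor_succ hq0 hq1 hl θ k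
  have he := exp_neg_mul_exp ψ
  have hI := Complex.I_sq
  have hs := rpow_half_sq hq0
  rw [coeffP_eq hq0 hq1 hl, coeffP_eq hq0 hq1 hl, coeffP_eq hq0 hq1 hl]
  push_cast at ha hb ⊢
  have hqk : (q : ℂ) ^ k ≠ 0 := pow_ne_zero _ hqc
  rw [pow_succ _ (k + 1), pow_succ _ k]
  rw [pow_succ (q : ℂ) k] at ha hb hφ
  generalize Complex.exp (-(Complex.I * ψ)) = e' at *
  generalize Complex.exp (Complex.I * ψ) = e at *
  generalize ((q ^ l : ℝ) : ℂ) = u at *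
  generalize ((q ^ (1 / 2 : ℝ) : ℝ) : ℂ) = s at *
  generalize (q : ℂ) ^ k = K at *
  have hdiv : (1 - (q : ℂ)) * (2 * s / (1 - q)) = 2 * s := mul_div_cancel₀ _ hd
  -- The factor `(-i)²` supplies the minus sign between the outer terms of `phiFactor_succ`, whereas
  -- both signs in the Jacobi recurrence are positive.
  have hx : e' * (e * -Complex.I * s) ^ 2 = -(e * q) := by
    linear_combination e * Complex.I ^ 2 * s ^ 2 * he + e * s ^ 2 * hI - e * hs
  have hx1 : (e * -Complex.I * s) * s = -(e * Complex.I * q) := by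
    linear_combination -(e * Complex.I) * hs
  generalize e * -Complex.I * s = x at *
  generalize x ^ k = Y at *
  -- The multiplier `(1-q) q^{l+k+1}` clears the denominators of `a_{k+1}` and of the eigenvalue;
  -- the identity for `a_k` needs an extra factor `q`.
  refine mul_left_cancel₀ (mul_ne_zero (mul_ne_zero hd hu) (mul_ne_zero hqk hqc)) ?_
  linear_combination (Y * e * q * phiFactor q l θ k) * hb +
    (Y * e' * x ^ 2 * phiFactor q l θ (k + 2)) * ha +
    (Y * sqrtRatio q l (k + 1) * phiFactor q l θ (k + 2) * (1 - u ^ 2 * (K * q))) * hx -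
    (Y * sqrtRatio q l (k + 1) * e * q) * hφ +
    (2 * u * K * q * Complex.cosh θ * sqrtRatio q l (k + 1) * phiFactor q l θ (k + 1) * Y) * hx1 +
    (u * K * q * Complex.cosh θ * sqrtRatio q l (k + 1) * phiFactor q l θ (k + 1) * Y * x) * hdiv

theorem formalI4_eq_smul_iff (hq0 : 0 < q) (hq1 : q < 1) (ψ : ℝ) (lam : ℂ) (b : ℕ → ℂ) :
    formalI4 q l ψ b = lam • b ↔
      Complex.exp (-(Complex.I * ψ)) * jacobiCoeff q l 0 * b 1 = lam * b 0 ∧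
      ∀ k, Complex.exp (Complex.I * ψ) * jacobiCoeff q l k * b k +
        Complex.exp (-(Complex.I * ψ)) * jacobiCoeff q l (k + 1) * b (k + 2) =
          lam * b (k + 1) := by
  simp only [← formalI4_apply_zero hq0 hq1, ← formalI4_apply_succ hq0 hq1]
  constructor
  · intro h
    simp [h]
  · rintro ⟨h0, h1⟩
    funext k
    cases k with
    | zero => exact h0
    | succ k => exact h1 k

theorem exp_mul_jacobiCoeff_ne_zero (hq0 : 0 < q) (hq1 : q < 1) (hl : 0 < l) (ψ : ℝ) (k : ℕ) :
    Complex.exp (-(Complex.I * ψ)) * jacobiCoeff q l k ≠ 0 :=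
  mul_ne_zero (Complex.exp_ne_zero _) (by exact_mod_cast (jacobiCoeff_pos hq0 hq1 hl k).ne')

theorem formalI4_coeffP (hq0 : 0 < q) (hq1 : q < 1) (hl : 0 < l) (ψ : ℝ) (θ : ℂ) :
    formalI4 q l ψ (coeffP q l ψ θ) =
      (-(2 * ((q ^ (1 / 2 : ℝ) : ℝ) : ℂ) / (1 - q)) * Complex.cosh θ) • coeffP q l ψ θ :=
  (formalI4_eq_smul_iff hq0 hq1 _ _ _).mpr
    ⟨coeffP_recurrence_zero hq0 hq1 hl ψ θ, coeffP_recurrence_succ hq0 hq1 hl ψ θ⟩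

/-- The coefficient of the highest-index term in each equation is nonzero, so the recurrence can be
solved upwards from `b 0`. -/
theorem eq_of_formalI4_eq_smul (hq0 : 0 < q) (hq1 : q < 1) (hl : 0 < l) {ψ : ℝ} {lam : ℂ}
    {b c : ℕ → ℂ} (hb : formalI4 q l ψ b = lam • b) (hc : formalI4 q l ψ c = lam • c)
    (h0 : b 0 = c 0) : b = c := by
  obtain ⟨hb0, hb1⟩ := (formalI4_eq_smul_iff hq0 hq1 _ _ _).mp hb
  obtain ⟨hc0, hc1⟩ := (formalI4_eq_smul_iff hq0 hq1 _ _ _).mp hc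
  funext k
  induction k using Nat.twoStepInduction with
  | zero => exact h0
  | one =>
    refine mul_left_cancel₀ (exp_mul_jacobiCoeff_ne_zero hq0 hq1 hl ψ 0) ?_
    rw [hb0, hc0, h0]
  | more k ih0 ih1 =>
    refine mul_left_cancel₀ (exp_mul_jacobiCoeff_ne_zero hq0 hq1 hl ψ (k + 1)) ?_
    have hk := hb1 k
    rw [ih0, ih1, ← hc1 k] at hk
    exact add_left_cancel hk

theorem formalI4_eq_smul_iff_coeffP (hq0 : 0 < q) (hq1 : q < 1) (hl : 0 < l) (ψ : ℝ) (θ : ℂ)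
    (b : ℕ → ℂ) :
    formalI4 q l ψ b =
      (-(2 * ((q ^ (1 / 2 : ℝ) : ℝ) : ℂ) / (1 - q)) * Complex.cosh θ) • b ↔
      ∀ k, b k = b 0 * coeffP q l ψ θ k := by
  have hP : formalI4 q l ψ (b 0 • coeffP q l ψ θ) =
      (-(2 * ((q ^ (1 / 2 : ℝ) : ℝ) : ℂ) / (1 - q)) * Complex.cosh θ) •
        (b 0 • coeffP q l ψ θ) := by
    rw [map_smul, formalI4_coeffP hq0 hq1 hl, smul_comm]
  constructor
  · intro h k
    exact congrFun (eq_of_formalI4_eq_smul hq0 hq1 hl h hP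
      (by simp [coeffP_zero hq0 hq1 hl])) k
  · intro h
    have e : b = b 0 • coeffP q l ψ θ := funext h
    rw [e]
    simpa [coeffP_zero hq0 hq1 hl] using hP

theorem exists_eq_mul_cosh (hq0 : 0 < q) (hq1 : q < 1) (lam : ℂ) :
    ∃ θ : ℂ, lam = -(2 * ((q ^ (1 / 2 : ℝ) : ℝ) : ℂ) / (1 - q)) * Complex.cosh θ := by
  have hs : ((q ^ (1 / 2 : ℝ) : ℝ) : ℂ) ≠ 0 := by
    exact_mod_cast (Real.rpow_pos_of_pos hq0 _).ne'
  have hd : 1 - (q : ℂ) ≠ 0 := by simpa using one_sub_cpow_ne_zero hq0 hq1 0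
  obtain ⟨z, hz⟩ := Complex.cos_surjective
    (lam / -(2 * ((q ^ (1 / 2 : ℝ) : ℝ) : ℂ) / (1 - q)))
  refine ⟨z * Complex.I, ?_⟩
  rw [Complex.cosh_mul_I, hz, mul_div_cancel₀]
  exact neg_ne_zero.mpr (div_ne_zero (mul_ne_zero two_ne_zero hs) hd)

open Polynomial in
theorem exists_polynomial_coeffP (hq0 : 0 < q) (hq1 : q < 1) (hl : 0 < l) (ψ : ℝ) (k : ℕ) :
    ∃ p : Polynomial ℂ, p.degree = k ∧ ∀ θ : ℂ, coeffP q l ψ θ k =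
      p.eval (-(2 * ((q ^ (1 / 2 : ℝ) : ℝ) : ℂ) / (1 - q)) * Complex.cosh θ) := by
  have hne := exp_mul_jacobiCoeff_ne_zero hq0 hq1 hl ψ
  induction k using Nat.twoStepInduction with
  | zero => exact ⟨1, by simp, fun θ => by simp [coeffP_zero hq0 hq1 hl]⟩
  | one =>
    refine ⟨C (Complex.exp (-(Complex.I * ψ)) * jacobiCoeff q l 0)⁻¹ * X, ?_, fun θ => ?_⟩
    · rw [degree_C_mul (inv_ne_zero (hne 0)), degree_X, Nat.cast_one]
    · rw [eval_mul, eval_C, eval_X, eq_inv_mul_iff_mul_eq₀ (hne 0),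
        coeffP_recurrence_zero hq0 hq1 hl, coeffP_zero hq0 hq1 hl, mul_one]
  | more k ih0 ih1 =>
    obtain ⟨p0, hd0, hp0⟩ := ih0
    obtain ⟨p1, hd1, hp1⟩ := ih1
    refine ⟨C (Complex.exp (-(Complex.I * ψ)) * jacobiCoeff q l (k + 1))⁻¹ *
      (X * p1 - C (Complex.exp (Complex.I * ψ) * jacobiCoeff q l k) * p0), ?_, fun θ => ?_⟩
    · have hX : (X * p1).degree = ((k + 2 : ℕ) : WithBot ℕ) := by
        rw [degree_mul, degree_X, hd1, ← Nat.cast_one, ← Nat.cast_add]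
        congr 1
        omega
      rw [degree_C_mul (inv_ne_zero (hne (k + 1))), degree_sub_eq_left_of_degree_lt, hX]
      rw [hX, degree_C_mul (mul_ne_zero (Complex.exp_ne_zero _)
        (by exact_mod_cast (jacobiCoeff_pos hq0 hq1 hl k).ne')), hd0]
      exact_mod_cast (by omega : k < k + 2)
    · rw [eval_mul, eval_C, eval_sub, eval_mul, eval_X, eval_mul, eval_C, ← hp0, ← hp1,
        eq_inv_mul_iff_mul_eq₀ (hne (k + 1)), ← coeffP_recurrence_succ hq0 hq1 hl]
      ring

theorem tendsto_inv_jacobiCoeff (hq0 : 0 < q) (hq1 : q < 1) (hl : 0 < l) :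
    Tendsto (fun k => (jacobiCoeff q l k)⁻¹) atTop (𝓝 0) :=
  (summable_inv_jacobiCoeff hq0 hq1 hl).tendsto_atTop_zero

/-- Every formal eigenvector is square summable, since `‖b_{k+2}‖ ≤ ε_k ‖b_{k+1}‖ + q ‖b_k‖` with
`ε_k → 0`. -/
theorem memℓp_of_formalI4_eq_smul (hq0 : 0 < q) (hq1 : q < 1) (hl : 0 < l) {ψ : ℝ} {lam : ℂ}
    {b : ℕ → ℂ} (hb : formalI4 q l ψ b = lam • b) : Memℓp b 2 := by
  obtain ⟨-, hb1⟩ := (formalI4_eq_smul_iff hq0 hq1 _ _ _).mp hb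
  have he : ‖Complex.exp (Complex.I * ψ)‖ = 1 := by
    rw [mul_comm]; exact Complex.norm_exp_ofReal_mul_I ψ
  have he' : ‖Complex.exp (-(Complex.I * ψ))‖ = 1 := by
    rw [Complex.exp_neg, norm_inv, he, inv_one]
  have hs0 : 0 < √q := Real.sqrt_pos.mpr hq0
  have hs1 : √q < 1 := by rw [Real.sqrt_lt' one_pos]; simpa using hq1
  have hss : √q * √q = q := Real.mul_self_sqrt hq0.le
  have hstep : ∀ k, ‖b (k + 2)‖ ≤
      ‖lam‖ * (jacobiCoeff q l (k + 1))⁻¹ * ‖b (k + 1)‖ + q * ‖b k‖ := by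
    intro k
    have ha := jacobiCoeff_pos hq0 hq1 hl k
    have ha1 := jacobiCoeff_pos hq0 hq1 hl (k + 1)
    have h1 : jacobiCoeff q l (k + 1) * ‖b (k + 2)‖ ≤
        ‖lam‖ * ‖b (k + 1)‖ + jacobiCoeff q l k * ‖b k‖ := by
      have := norm_sub_le (lam * b (k + 1))
        (Complex.exp (Complex.I * ψ) * jacobiCoeff q l k * b k)
      rw [← hb1 k, add_sub_cancel_left, hb1 k] at this
      simpa [he, he', abs_of_pos ha, abs_of_pos ha1] using this
    have h2 : jacobiCoeff q l k * ‖b k‖ ≤ q * jacobiCoeff q l (k + 1) * ‖b k‖ :=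
      mul_le_mul_of_nonneg_right (jacobiCoeff_le hq0 hq1 hl k) (norm_nonneg _)
    refine le_of_mul_le_mul_left ?_ ha1
    calc _ ≤ ‖lam‖ * ‖b (k + 1)‖ + q * jacobiCoeff q l (k + 1) * ‖b k‖ := by linarith
      _ = _ := by field_simp
  have hev : ∀ᶠ k in atTop, ‖lam‖ * (jacobiCoeff q l (k + 1))⁻¹ ≤ (1 - √q) / 2 := by
    have := ((tendsto_inv_jacobiCoeff hq0 hq1 hl).comp (tendsto_add_atTop_nat 1)).const_mul ‖lam‖
    rw [mul_zero] at this
    exact this.eventually_le_const (by linarith)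
  -- The weight `√q` balances the limiting recurrence `‖b_{k+2}‖ ≤ q ‖b_k‖`. With `ε_k ≤ (1-√q)/2`,
  -- the coefficient of `‖b_{k+1}‖` becomes at most `√q + ε_k ≤ (1+√q)/2`, and `q = √q · √q` handles
  -- `‖b_k‖`. The result is in fact absolute summability.
  have hsum : Summable fun k => ‖b (k + 1)‖ + √q * ‖b k‖ := by
    refine summable_of_ratio_norm_eventually_le (r := (1 + √q) / 2) (by linarith) ?_
    filter_upwards [hev] with k hk
    rw [Real.norm_of_nonneg (by positivity), Real.norm_of_nonneg (by positivity)]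
    have h1 := hstep k
    have h2 := mul_le_mul_of_nonneg_right hk (norm_nonneg (b (k + 1)))
    have h3 : √q * (√q * ‖b k‖) ≤ (1 + √q) / 2 * (√q * ‖b k‖) :=
      mul_le_mul_of_nonneg_right (by linarith) (by positivity)
    rw [← mul_assoc, hss] at h3
    linarith
  have hb' : Summable fun k => ‖b (k + 1)‖ :=
    hsum.of_nonneg_of_le (fun _ => norm_nonneg _)
      fun k => le_add_of_nonneg_right (by positivity)
  have h1 : Memℓp b 1 := by
    refine memℓp_gen ?_
    simp only [ENNReal.toReal_one, Real.rpow_one]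
    exact (summable_nat_add_iff 1).mp hb'
  exact h1.of_exponent_ge (by norm_num)

end FormalEigenvectors

/-! ### The operator in the Hilbert space, its adjoint and defect spaces -/

section HilbertSpace

open scoped LinearPMap

variable {q l : ℝ}

theorem conj_exp_I_mul (ψ : ℝ) :
    conj (Complex.exp (Complex.I * ψ)) = Complex.exp (-(Complex.I * ψ)) := by
  rw [← Complex.exp_conj]; simp

theorem conj_exp_neg_I_mul (ψ : ℝ) :
    conj (Complex.exp (-(Complex.I * ψ))) = Complex.exp (Complex.I * ψ) := by
  rw [← Complex.exp_conj]; simp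

/-- Discrete Green identity: the interior terms cancel because the entries are real, and a
Wronskian-type boundary term remains. -/
theorem sum_formalI4_sub (hq0 : 0 < q) (hq1 : q < 1) (ψ : ℝ) (y v : ℕ → ℂ) (N : ℕ) :
    ∑ k ∈ range (N + 1), (formalI4 q l ψ v k * conj (y k) - v k * conj (formalI4 q l ψ y k)) =
      Complex.exp (-(Complex.I * ψ)) * jacobiCoeff q l N * v (N + 1) * conj (y N) -
        Complex.exp (Complex.I * ψ) * jacobiCoeff q l N * v N * conj (y (N + 1)) := by
  induction N with
  | zero =>
    rw [sum_range_one, formalI4_apply_zero hq0 hq1, formalI4_apply_zero hq0 hq1]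
    simp only [map_mul, Complex.conj_ofReal, conj_exp_neg_I_mul]
    ring
  | succ N ih =>
    rw [sum_range_succ, ih, formalI4_apply_succ hq0 hq1, formalI4_apply_succ hq0 hq1]
    simp only [map_mul, map_add, Complex.conj_ofReal, conj_exp_neg_I_mul, conj_exp_I_mul]
    ring

theorem opI4_apply (ψ : ℝ) (v : (opI4 q l ψ).domain) (k : ℕ) :
    (opI4 q l ψ v : ℕ → ℂ) k = formalI4 q l ψ (v : HilbertL) k := rfl

/-- Here `y` need not be finitely supported: `w = I₄ y` gives symmetry, and `w = z • y` gives
membership in a defect space. -/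
theorem inner_opI4_right (hq0 : 0 < q) (hq1 : q < 1) (ψ : ℝ) {y w : HilbertL}
    (hw : formalI4 q l ψ y = w) (v : (opI4 q l ψ).domain) :
    inner ℂ w (v : HilbertL) = inner ℂ y (opI4 q l ψ v) := by
  have hv : (Function.support ((v : HilbertL) : ℕ → ℂ)).Finite := v.2
  obtain ⟨N, hN⟩ := hv.bddAbove
  have h0 : ∀ k, N < k → (v : HilbertL) k = 0 := by
    intro k hk
    by_contra h
    exact absurd (hN (Function.mem_support.mpr h)) (by omega)
  have hs := (lp.hasSum_inner (𝕜 := ℂ) y (opI4 q l ψ v)).sub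
    (lp.hasSum_inner (𝕜 := ℂ) w (v : HilbertL))
  -- The operator enlarges the support by one index, hence `N + 2`; the boundary term at `N + 1`
  -- then involves only vanishing coefficients of `v`.
  have hz : ∀ k ∉ range (N + 2), inner ℂ (y k) ((opI4 q l ψ v : HilbertL) k) -
      inner ℂ (w k) ((v : HilbertL) k) = 0 := by
    intro k hk
    rw [mem_range, not_lt] at hk
    obtain ⟨j, rfl⟩ : ∃ j, k = j + 1 := ⟨k - 1, by omega⟩
    rw [opI4_apply, formalI4_apply_succ hq0 hq1, h0 j (by omega), h0 (j + 1) (by omega),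
      h0 (j + 2) (by omega)]
    simp
  have h := hs.unique (hasSum_sum_of_ne_finset_zero hz)
  have hg := sum_formalI4_sub (l := l) hq0 hq1 ψ y (v : HilbertL) (N + 1)
  rw [h0 (N + 1) (by omega), h0 (N + 1 + 1) (by omega)] at hg
  rw [eq_comm, ← sub_eq_zero, h]
  simp only [hw] at hg
  simpa [RCLike.inner_apply, opI4_apply] using hg

theorem opI4_isFormalAdjoint (hq0 : 0 < q) (hq1 : q < 1) (ψ : ℝ) :
    (opI4 q l ψ).IsFormalAdjoint (opI4 q l ψ) :=
  fun _ v => inner_opI4_right hq0 hq1 ψ rfl v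

theorem basisVec_mem (ψ : ℝ) (k : ℕ) : basisVec k ∈ (opI4 q l ψ).domain := by
  refine (Set.finite_singleton k).subset fun j hj => ?_
  by_contra h
  exact hj (lp.single_apply_ne _ _ _ h)

theorem basisVec_apply (k j : ℕ) : (basisVec k : ℕ → ℂ) j = if j = k then 1 else 0 := by
  rw [basisVec, lp.single_apply, Pi.single_apply]

theorem dense_opI4_domain (ψ : ℝ) : Dense ((opI4 q l ψ).domain : Set HilbertL) := by
  intro f
  refine mem_closure_of_tendsto (lp.hasSum_single (by norm_num) f).tendsto_sum_nat
    (Eventually.of_forall fun n => ?_)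
  refine Submodule.sum_mem _ fun k _ => ?_
  have : lp.single 2 k (f k) = f k • basisVec k := by
    rw [basisVec, ← lp.single_smul, smul_eq_mul, mul_one]
  rw [this]
  exact Submodule.smul_mem _ _ (basisVec_mem ψ k)

/-- A symmetric densely defined operator is contained in its adjoint, which is closed. -/
theorem opI4_isClosable (hq0 : 0 < q) (hq1 : q < 1) (ψ : ℝ) : (opI4 q l ψ).IsClosable :=
  (LinearPMap.adjoint_isClosed (dense_opI4_domain ψ)).isClosable.leIsClosable
    ((opI4_isFormalAdjoint hq0 hq1 ψ).le_adjoint (dense_opI4_domain ψ))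

theorem opI4_unbounded (hq0 : 0 < q) (hq1 : q < 1) (hl : 0 < l) (ψ : ℝ) :
    ¬ ∃ C : ℝ, ∀ v : (opI4 q l ψ).domain, ‖opI4 q l ψ v‖ ≤ C * ‖v‖ := by
  rintro ⟨C, hC⟩
  have he : ‖Complex.exp (Complex.I * ψ)‖ = 1 := by
    rw [mul_comm]; exact Complex.norm_exp_ofReal_mul_I ψ
  have hbound : ∀ k, jacobiCoeff q l k ≤ C := by
    intro k
    have h1 := hC ⟨basisVec k, basisVec_mem ψ k⟩
    have h2 : ‖(⟨basisVec k, basisVec_mem ψ k⟩ : (opI4 q l ψ).domain)‖ = 1 := by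
      change ‖(lp.single 2 k (1 : ℂ) : HilbertL)‖ = 1
      rw [lp.norm_single (by norm_num), norm_one]
    have h3 := lp.norm_apply_le_norm (by norm_num)
      (opI4 q l ψ ⟨basisVec k, basisVec_mem ψ k⟩) (k + 1)
    rw [opI4_apply, formalI4_apply_succ hq0 hq1] at h3
    simp only [basisVec_apply, if_true] at h3
    rw [if_neg (by omega), mul_zero, add_zero, mul_one, norm_mul, he, one_mul,
      Complex.norm_of_nonneg (jacobiCoeff_pos hq0 hq1 hl k).le] at h3
    rw [h2, mul_one] at h1
    exact h3.trans h1
  have hCpos : 0 < C := (jacobiCoeff_pos hq0 hq1 hl 0).trans_le (hbound 0)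
  refine absurd (ge_of_tendsto' (tendsto_inv_jacobiCoeff hq0 hq1 hl) fun k =>
    inv_anti₀ (jacobiCoeff_pos hq0 hq1 hl k) (hbound k)) ?_
  simpa using hCpos

theorem rephasedVec_mem (ψ : ℝ) (k : ℕ) : rephasedVec ψ k ∈ (opI4 q l ψ).domain :=
  Submodule.smul_mem _ _ (basisVec_mem ψ k)

theorem rephasedVec_apply (ψ : ℝ) (k j : ℕ) :
    (rephasedVec ψ k : ℕ → ℂ) j = if j = k then Complex.exp (Complex.I * ψ) ^ k else 0 := by
  have e1 : Complex.exp (Complex.I * k * ψ) = Complex.exp (Complex.I * ψ) ^ k := by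
    rw [← Complex.exp_nat_mul]; ring_nf
  rw [rephasedVec, lp.coeFn_smul, Pi.smul_apply, basisVec_apply, e1]
  simp

theorem opI4_rephasedVec (hq0 : 0 < q) (hq1 : q < 1) (ψ : ℝ) (k : ℕ) :
    opI4 q l ψ ⟨rephasedVec ψ k, rephasedVec_mem ψ k⟩ =
      (jacobiCoeff q l k : ℂ) • rephasedVec ψ (k + 1) +
        if k = 0 then 0 else (jacobiCoeff q l (k - 1) : ℂ) • rephasedVec ψ (k - 1) := by
  have he := exp_neg_mul_exp ψ
  apply lp.ext
  funext j
  rw [opI4_apply, lp.coeFn_add, Pi.add_apply, lp.coeFn_smul, Pi.smul_apply, smul_eq_mul,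
    rephasedVec_apply]
  rcases k with _ | k
  · rw [if_pos rfl, lp.coeFn_zero, Pi.zero_apply, add_zero]
    rcases j with _ | j
    · rw [formalI4_apply_zero hq0 hq1]
      simp [rephasedVec_apply]
    · rw [formalI4_apply_succ hq0 hq1]
      rcases eq_or_ne j 0 with rfl | hj
      · simp [rephasedVec_apply, mul_comm]
      · simp [rephasedVec_apply, hj]
  · rw [if_neg (Nat.succ_ne_zero k), lp.coeFn_smul, Pi.smul_apply, smul_eq_mul,
      Nat.add_sub_cancel, rephasedVec_apply]
    rcases j with _ | j
    · rw [formalI4_apply_zero hq0 hq1]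
      simp only [rephasedVec_apply]
      rcases eq_or_ne k 0 with rfl | hk
      · simp
        linear_combination (jacobiCoeff q l 0 : ℂ) * he
      · simp [hk, hk.symm]
    · rw [formalI4_apply_succ hq0 hq1]
      simp only [rephasedVec_apply]
      rcases eq_or_ne j (k + 1) with rfl | h1
      · rw [if_pos rfl, if_neg (by omega), if_pos rfl, if_neg (by omega)]
        ring
      rcases eq_or_ne (j + 1) k with rfl | h2
      · rw [if_neg h1, if_pos rfl, if_neg (by omega), if_pos rfl]
        linear_combination
          (jacobiCoeff q l (j + 1) : ℂ) * Complex.exp (Complex.I * ψ) ^ (j + 1) * he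
      · rw [if_neg h1, if_neg (by omega), if_neg (by omega), if_neg h2]
        ring

theorem inner_rephasedVec_right (ψ : ℝ) (y : HilbertL) (k : ℕ) :
    inner ℂ y (rephasedVec ψ k) = Complex.exp (Complex.I * ψ) ^ k * conj (y k) := by
  have e1 : Complex.exp (Complex.I * k * ψ) = Complex.exp (Complex.I * ψ) ^ k := by
    rw [← Complex.exp_nat_mul]; ring_nf
  rw [rephasedVec, inner_smul_right, basisVec, lp.inner_single_right, RCLike.inner_apply, one_mul,
    e1]

/-- The defect spaces of the closure consist of the square summable formal eigenvectors. -/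
theorem mem_defect_iff (hq0 : 0 < q) (hq1 : q < 1) (ψ : ℝ) (z : ℂ) (y : HilbertL) :
    (∃ h : y ∈ (opI4 q l ψ).closure†.domain, (opI4 q l ψ).closure† ⟨y, h⟩ = z • y) ↔
      formalI4 q l ψ y = z • (y : ℕ → ℂ) := by
  set A := opI4 q l ψ
  have hle : A ≤ A.closure := A.le_closure
  have hcl : A.IsClosable := opI4_isClosable hq0 hq1 ψ
  have hdense : Dense (A.closure.domain : Set HilbertL) :=
    (dense_opI4_domain ψ).mono hle.1
  constructor
  · rintro ⟨h, hz⟩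
    -- Only the action of the adjoint against finite vectors is needed; testing on the rephased
    -- basis then recovers the recurrence, up to conjugation.
    have key : ∀ v : A.domain, inner ℂ (z • y) (v : HilbertL) = inner ℂ y (A v) := by
      intro v
      have := LinearPMap.adjoint_isFormalAdjoint hdense ⟨y, h⟩ ⟨v, hle.1 v.2⟩
      rw [hz, ← hle.2 (x := v) (y := ⟨v, hle.1 v.2⟩) rfl] at this
      exact this
    have key' : ∀ k, Complex.exp (Complex.I * ψ) ^ k * conj (z * y k) =
        inner ℂ y (A ⟨rephasedVec ψ k, rephasedVec_mem ψ k⟩) := by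
      intro k
      rw [← key ⟨_, rephasedVec_mem ψ k⟩, inner_rephasedVec_right]
      rfl
    have he := exp_neg_mul_exp ψ
    refine (formalI4_eq_smul_iff hq0 hq1 ψ z y).mpr ⟨?_, fun k => ?_⟩
    · have h0 := key' 0
      rw [opI4_rephasedVec hq0 hq1, if_pos rfl, add_zero, inner_smul_right,
        inner_rephasedVec_right] at h0
      apply (starRingEnd ℂ).injective
      simp only [map_mul, Complex.conj_ofReal, conj_exp_neg_I_mul] at h0 ⊢
      linear_combination -h0
    · have hk := key' (k + 1)
      rw [opI4_rephasedVec hq0 hq1, if_neg (Nat.succ_ne_zero k), inner_add_right,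
        inner_smul_right, inner_smul_right, inner_rephasedVec_right, inner_rephasedVec_right,
        Nat.add_sub_cancel] at hk
      apply (starRingEnd ℂ).injective
      simp only [map_mul, map_add, Complex.conj_ofReal, conj_exp_neg_I_mul,
        conj_exp_I_mul] at hk ⊢
      have hne : Complex.exp (Complex.I * ψ) ^ (k + 1) ≠ 0 := pow_ne_zero _ (Complex.exp_ne_zero _)
      refine mul_left_cancel₀ hne ?_
      linear_combination (Complex.exp (Complex.I * ψ) ^ k * jacobiCoeff q l k * conj (y k)) * he - hk
  · intro hy
    -- The relation is closed in the product space and holds on the graph of `A`, so it passes to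
    -- the graph of the closure.
    have key : ∀ x : A.closure.domain, inner ℂ (z • y) (x : HilbertL) = inner ℂ y (A.closure x) := by
      intro x
      have hx : ((x : HilbertL), A.closure x) ∈ A.graph.topologicalClosure := by
        rw [hcl.graph_closure_eq_closure_graph]
        exact A.closure.mem_graph x
      have hclosed : IsClosed {p : HilbertL × HilbertL | inner ℂ (z • y) p.1 = inner ℂ y p.2} :=
        isClosed_eq (by fun_prop) (by fun_prop)
      refine closure_minimal ?_ hclosed hx
      intro p hp
      obtain ⟨v, hv1, hv2⟩ := (LinearPMap.mem_graph_iff A).mp hp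
      change inner ℂ (z • y) p.1 = inner ℂ y p.2
      rw [← hv1, ← hv2]
      exact inner_opI4_right hq0 hq1 ψ hy v
    have hmem : y ∈ A.closure†.domain :=
      LinearPMap.mem_adjoint_domain_of_exists _ ⟨z • y, key⟩
    exact ⟨hmem, LinearPMap.adjoint_apply_eq hdense _ key⟩

theorem mem_defectSpace_iff {H : Type*} [NormedAddCommGroup H] [InnerProductSpace ℂ H]
    [CompleteSpace H] {A : H →ₗ.[ℂ] H} {z : ℂ} {w : A†.domain} :
    w ∈ defectSpace A z ↔ A† w = z • (w : H) := by
  rw [defectSpace, LinearMap.mem_ker, LinearMap.sub_apply, sub_eq_zero]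
  rfl

theorem exists_eigenvector (hq0 : 0 < q) (hq1 : q < 1) (hl : 0 < l) (ψ : ℝ) (z : ℂ) :
    ∃ y : HilbertL, y 0 = 1 ∧ formalI4 q l ψ y = z • (y : ℕ → ℂ) := by
  obtain ⟨θ, hθ⟩ := exists_eq_mul_cosh hq0 hq1 z
  have h := formalI4_coeffP hq0 hq1 hl ψ θ
  rw [← hθ] at h
  exact ⟨⟨coeffP q l ψ θ, memℓp_of_formalI4_eq_smul hq0 hq1 hl h⟩, coeffP_zero hq0 hq1 hl ψ θ, h⟩

/-- The eigenvector with zeroth coefficient 1 spans, with `w 0` as the coordinate of `w`. -/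
theorem rank_defectSpace (hq0 : 0 < q) (hq1 : q < 1) (hl : 0 < l) (ψ : ℝ) (z : ℂ) :
    Module.rank ℂ (defectSpace (opI4 q l ψ).closure z) = 1 := by
  obtain ⟨y, hy0, hy⟩ := exists_eigenvector hq0 hq1 hl ψ z
  obtain ⟨hmem, hz⟩ := (mem_defect_iff hq0 hq1 ψ z y).mpr hy
  refine rank_eq_one (⟨⟨y, hmem⟩, mem_defectSpace_iff.mpr hz⟩ : defectSpace _ z) ?_ ?_
  · intro h
    have hy' : y = 0 := congrArg (fun w : defectSpace _ z => ((w : _) : HilbertL)) h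
    rw [hy', lp.coeFn_zero, Pi.zero_apply] at hy0
    exact zero_ne_one hy0
  · rintro ⟨⟨w, hw⟩, hwz⟩
    have hw' := (mem_defect_iff hq0 hq1 ψ z w).mp ⟨hw, mem_defectSpace_iff.mp hwz⟩
    refine ⟨w 0, Subtype.ext (Subtype.ext ?_)⟩
    change w 0 • y = w
    apply lp.ext
    refine eq_of_formalI4_eq_smul hq0 hq1 hl (ψ := ψ) (lam := z) ?_ hw' ?_
    · rw [lp.coeFn_smul, map_smul, hy, smul_comm]
    · rw [lp.coeFn_smul, Pi.smul_apply, hy0, smul_eq_mul, mul_one]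

theorem hasDeficiencyIndices_closure (hq0 : 0 < q) (hq1 : q < 1) (hl : 0 < l) (ψ : ℝ) :
    HasDeficiencyIndices (opI4 q l ψ).closure 1 1 :=
  ⟨rank_defectSpace hq0 hq1 hl ψ _, rank_defectSpace hq0 hq1 hl ψ _⟩

theorem not_isSelfAdjoint_closure (hq0 : 0 < q) (hq1 : q < 1) (hl : 0 < l) (ψ : ℝ) :
    ¬ IsSelfAdjoint (opI4 q l ψ).closure := by
  intro hsa
  obtain ⟨y, hy0, hy⟩ := exists_eigenvector hq0 hq1 hl ψ Complex.I
  have hex := (mem_defect_iff hq0 hq1 ψ Complex.I y).mpr hy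
  have hadj := LinearPMap.adjoint_isFormalAdjoint hsa.dense_domain
  rw [LinearPMap.isSelfAdjoint_def.mp hsa] at hex hadj
  obtain ⟨hmem, hz⟩ := hex
  -- Symmetry at an eigenvector for `i` reads `-i ⟨y, y⟩ = i ⟨y, y⟩`, which forces `y = 0`.
  have h := hadj ⟨y, hmem⟩ ⟨y, hmem⟩
  rw [hz] at h
  simp only [inner_smul_left, inner_smul_right, Complex.conj_I] at h
  have h2 : inner ℂ y y = 0 := by
    have : 2 * Complex.I * inner ℂ y y = 0 := by linear_combination -h
    simpa using this
  rw [inner_self_eq_zero.mp h2, lp.coeFn_zero, Pi.zero_apply] at hy0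
  exact zero_ne_one hy0

end HilbertSpace

end SUq11

end

theorem mainTheorem7 (q l ψ : ℝ) (hq0 : 0 < q) (hq1 : q < 1) (hl : 0 < l) :
    -- `I₄` is a densely defined, symmetric, closable, unbounded operator
    (Dense ((SUq11.opI4 q l ψ).domain : Set SUq11.HilbertL) ∧
      (SUq11.opI4 q l ψ).IsFormalAdjoint (SUq11.opI4 q l ψ) ∧
      (SUq11.opI4 q l ψ).IsClosable ∧
      ¬ ∃ C : ℝ, ∀ v : (SUq11.opI4 q l ψ).domain, ‖SUq11.opI4 q l ψ v‖ ≤ C * ‖v‖) ∧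
    -- it is a Jacobi matrix in the basis `e^{ikψ} f_k`
    (∀ k : ℕ, ∃ h : SUq11.rephasedVec ψ k ∈ (SUq11.opI4 q l ψ).domain,
      SUq11.opI4 q l ψ ⟨SUq11.rephasedVec ψ k, h⟩ =
        (SUq11.jacobiCoeff q l k : ℂ) • SUq11.rephasedVec ψ (k + 1) +
          if k = 0 then 0
          else (SUq11.jacobiCoeff q l (k - 1) : ℂ) • SUq11.rephasedVec ψ (k - 1)) ∧
    -- with positive, log-concave entries whose reciprocals are summable
    ((∀ k : ℕ, 0 < SUq11.jacobiCoeff q l k) ∧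
      (∀ k : ℕ, SUq11.jacobiCoeff q l k * SUq11.jacobiCoeff q l (k + 2) ≤
        SUq11.jacobiCoeff q l (k + 1) ^ 2) ∧
      Summable (fun k : ℕ => (SUq11.jacobiCoeff q l k)⁻¹)) ∧
    -- the closure is not selfadjoint and has deficiency indices (1,1)
    (¬ IsSelfAdjoint (SUq11.opI4 q l ψ).closure ∧
      SUq11.HasDeficiencyIndices (SUq11.opI4 q l ψ).closure 1 1) ∧
    -- the formal eigenvectors, for every complex eigenvalue
    (∀ lam : ℂ,
      (∃ θ : ℂ, lam = -(2 * ((q ^ (1 / 2 : ℝ) : ℝ) : ℂ) / (1 - q)) * Complex.cosh θ) ∧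
      ∀ θ : ℂ, lam = -(2 * ((q ^ (1 / 2 : ℝ) : ℝ) : ℂ) / (1 - q)) * Complex.cosh θ →
        ∀ b : ℕ → ℂ, SUq11.formalI4 q l ψ b = lam • b ↔
          ∀ k : ℕ, b k = b 0 * SUq11.coeffP q l ψ θ k) ∧
    -- their coefficients are polynomials of degree `k` in the eigenvalue
    (∀ k : ℕ, ∃ p : Polynomial ℂ, p.degree = k ∧ ∀ θ : ℂ,
      SUq11.coeffP q l ψ θ k =
        p.eval (-(2 * ((q ^ (1 / 2 : ℝ) : ℝ) : ℂ) / (1 - q)) * Complex.cosh θ)) :=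
  ⟨⟨SUq11.dense_opI4_domain ψ, SUq11.opI4_isFormalAdjoint hq0 hq1 ψ,
      SUq11.opI4_isClosable hq0 hq1 ψ, SUq11.opI4_unbounded hq0 hq1 hl ψ⟩,
    fun k => ⟨SUq11.rephasedVec_mem ψ k, SUq11.opI4_rephasedVec hq0 hq1 ψ k⟩,
    ⟨SUq11.jacobiCoeff_pos hq0 hq1 hl, SUq11.jacobiCoeff_mul_le_sq hq0 hq1 hl,
      SUq11.summable_inv_jacobiCoeff hq0 hq1 hl⟩,
    ⟨SUq11.not_isSelfAdjoint_closure hq0 hq1 hl ψ,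
      SUq11.hasDeficiencyIndices_closure hq0 hq1 hl ψ⟩,
    fun lam => ⟨SUq11.exists_eq_mul_cosh hq0 hq1 lam, fun θ hθ b => by
      rw [hθ]; exact SUq11.formalI4_eq_smul_iff_coeffP hq0 hq1 hl ψ θ b⟩,
    SUq11.exists_polynomial_coeffP hq0 hq1 hl ψ⟩
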